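/- Let $R$ be a commutative ring with $1$, let $f=(f_1,\dots,f_r)\in R^r$ and $g=(g_1,\dots,g_s)\in R^s$ ($r,s\ge 0$), and put $h=(f_1,\dots,f_r,g_1,\dots,g_s)$. Let $m_i=(k_i,l_i)\in\mathbb N^r\times\mathbb N^s$, $i=1,\dots,u$, be nonzero vectors, the rows of a matrix $M=(K\;L)$, and let $h^M$, $\bar f^K Y^L$ denote the families $h^{m_i}=f^{k_i}g^{l_i}$ in $R$ and $\bar f^{k_i}Y^{l_i}$ in $(R/\langle g\rangle)[Y_1,\dots,Y_s]$, where $\bar f$ is the image of $f$ in $R/\langle g\rangle$. For an ideal $I$ of a ring $S$ let $\operatorname{gr}_I S=\bigoplus_{l\ge0}I^l/I^{l+1}$, let $\operatorname{ord}_I(p)=\sup\{k: p\in I^k\}$, and for $p\notin\bigcap_k I^k$ let $\sigma_I(p)$ be the class of $p$ in $I^{\operatorname{ord}_I(p)}/I^{\operatorname{ord}_I(p)+1}$; write $\operatorname{gr}_g,\sigma_g,\operatorname{ord}_g$ for $I=\langle g\rangle$, and $\operatorname{gr}_{\bar g},\sigma_{\bar g},\operatorname{ord}_{\bar g}$ for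 the image of $\langle g\rangle$ in $R/\langle h^M\rangle$. Suppose that both $f_1,\dots,f_r,g_1,\dots,g_s$ and $g_1,\dots,g_s,f_1,\dots,f_r$ are regular sequences in $R$ (in particular $R\ne\langle h\rangle$), and that $R/\langle g\rangle$ is separated and complete for the $\langle\bar f\rangle$-adic filtration. Then the $R$-linear map $R^u\to R$, $e_i\mapsto h^{m_i}$, is $g$-strict, that is, for all $k\in\mathbb{N}$ $$\sum_{i=1}^u\langle g\rangle^{k-|l_i|}\,h^{m_i}=\langle g\rangle^k\cap\langle h^M\rangle ,$$ where $\langle g\rangle^{n}=R$ for $n\le 0$. Moreover the elements $g_j$ and $h^{m_i}$ do not lie in $\bigcap_k\langle g\rangle^k$, and the Rees map $\varphi_g\colon(R/\langle g\rangle)[Y]\to\operatorname{gr}_gR$, $Y_j\mapsto\sigma_g(g_j)$, induces the first of two isomorphisms of graded $R/\langle g\rangle$-algebras $$(R/\langle g\rangle)[Y]/\langle\bar f^KY^L\rangle\;\cong\;\operatorname{gr}_g(R)/\langle\sigma_g(h^M)\rangle\;\cong\;\operatorname{gr}_{\bar g}(R/\langle h^M\rangle).$$ The second one sends, for every $l$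 and every $x\in\langle g\rangle^l$, the class of $x+\langle g\rangle^{l+1}$ to $\bar x+\langle\bar g\rangle^{l+1}$; in particular it sends the class of $\sigma_g(x)$ to $\sigma_{\bar g}(\bar x)$ whenever $\operatorname{ord}_g(x)=\operatorname{ord}_{\bar g}(\bar x)<\infty$. -/

import Mathlib

open scoped DirectSum

noncomputable section

namespace ReesStrict

section Graded

variable {R : Type*} [CommRing R]

/-- The degree `l` piece `I ^ l / I ^ (l + 1)` of the associated `I`-graded ring. -/
def GrPiece (I : Ideal R) (l : ℕ) : Type _ :=
  ↥(I ^ l) ⧸ Submodule.comap (Submodule.subtype (I ^ l)) (I ^ (l + 1))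

instance (I : Ideal R) (l : ℕ) : AddCommGroup (GrPiece I l) :=
  inferInstanceAs (AddCommGroup
    (↥(I ^ l) ⧸ Submodule.comap (Submodule.subtype (I ^ l)) (I ^ (l + 1))))

/-- The residue class map `I ^ l → I ^ l / I ^ (l + 1)`. -/
def grMk (I : Ideal R) (l : ℕ) : ↥(I ^ l) →+ GrPiece I l :=
  (Submodule.mkQ (Submodule.comap (Submodule.subtype (I ^ l)) (I ^ (l + 1)))).toAddMonoidHom

theorem grMk_surjective (I : Ideal R) (l : ℕ) : Function.Surjective (grMk I l) :=
  Submodule.mkQ_surjective _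

theorem grMk_eq_iff {I : Ideal R} {l : ℕ} {x y : ↥(I ^ l)} :
    grMk I l x = grMk I l y ↔ (x : R) - y ∈ I ^ (l + 1) :=
  Submodule.Quotient.eq _

theorem gradedMk_eq {I : Ideal R} {i j : ℕ} (hij : i = j) (x : ↥(I ^ i)) (y : ↥(I ^ j))
    (h : (x : R) = y) :
    GradedMonoid.mk (A := GrPiece I) i (grMk I i x) = GradedMonoid.mk j (grMk I j y) := by
  subst hij
  rw [Subtype.ext h]

/-- The product `I ^ i × I ^ j → I ^ (i + j)`. -/
def powMul (I : Ideal R) {i j : ℕ} (x : ↥(I ^ i)) (y : ↥(I ^ j)) : ↥(I ^ (i + j)) :=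
  ⟨(x : R) * y, by rw [pow_add]; exact Ideal.mul_mem_mul x.2 y.2⟩

/-- Multiplication of residue classes on representatives. -/
def grMul (I : Ideal R) {i j : ℕ} : GrPiece I i → GrPiece I j → GrPiece I (i + j) :=
  Quotient.map₂ (powMul I) (by
    intro a b hab c d hcd
    have h1 : (a : R) - b ∈ I ^ (i + 1) := grMk_eq_iff.1 (Quotient.sound hab)
    have h2 : (c : R) - d ∈ I ^ (j + 1) := grMk_eq_iff.1 (Quotient.sound hcd)
    refine Quotient.exact (grMk_eq_iff (x := powMul I a c) (y := powMul I b d) |>.2 ?_)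
    change (a : R) * c - b * d ∈ I ^ (i + j + 1)
    have e : (a : R) * c - b * d = (a - b) * c + b * (c - d) := by ring
    rw [e]
    refine Ideal.add_mem _ ?_ ?_
    · have := Ideal.mul_mem_mul h1 c.2
      rwa [← pow_add, show i + 1 + j = i + j + 1 by omega] at this
    · have := Ideal.mul_mem_mul b.2 h2
      rwa [← pow_add, show i + (j + 1) = i + j + 1 by omega] at this)

theorem grMul_mk (I : Ideal R) {i j : ℕ} (x : ↥(I ^ i)) (y : ↥(I ^ j)) :
    grMul I (grMk I i x) (grMk I j y) = grMk I (i + j) (powMul I x y) := rfl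

instance (I : Ideal R) : GradedMonoid.GMul (GrPiece I) where
  mul := grMul I

instance (I : Ideal R) : GradedMonoid.GOne (GrPiece I) where
  one := grMk I 0 ⟨1, by simp⟩

instance (I : Ideal R) : GradedMonoid.GMonoid (GrPiece I) where
  one_mul := by
    rintro ⟨i, a⟩
    obtain ⟨a, rfl⟩ := grMk_surjective I i a
    exact gradedMk_eq (zero_add i) _ _ (one_mul _)
  mul_one := by
    rintro ⟨i, a⟩
    obtain ⟨a, rfl⟩ := grMk_surjective I i a
    exact gradedMk_eq (add_zero i) _ _ (mul_one _)
  mul_assoc := by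
    rintro ⟨i, a⟩ ⟨j, b⟩ ⟨k, c⟩
    obtain ⟨a, rfl⟩ := grMk_surjective I i a
    obtain ⟨b, rfl⟩ := grMk_surjective I j b
    obtain ⟨c, rfl⟩ := grMk_surjective I k c
    exact gradedMk_eq (add_assoc i j k) _ _ (mul_assoc _ _ _)

instance (I : Ideal R) : DirectSum.GCommRing (GrPiece I) where
  __ := (inferInstance : GradedMonoid.GMonoid (GrPiece I))
  mul_zero {i j} a := by
    obtain ⟨a, rfl⟩ := grMk_surjective I i a
    change grMul I _ _ = _
    rw [← map_zero (grMk I j), grMul_mk, ← map_zero (grMk I (i + j))]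
    congr 1
    exact Subtype.ext (mul_zero _)
  zero_mul {i j} a := by
    obtain ⟨a, rfl⟩ := grMk_surjective I j a
    change grMul I _ _ = _
    rw [← map_zero (grMk I i), grMul_mk, ← map_zero (grMk I (i + j))]
    congr 1
    exact Subtype.ext (zero_mul _)
  mul_add {i j} a b c := by
    obtain ⟨a, rfl⟩ := grMk_surjective I i a
    obtain ⟨b, rfl⟩ := grMk_surjective I j b
    obtain ⟨c, rfl⟩ := grMk_surjective I j c
    change grMul I _ _ = grMul I _ _ + grMul I _ _
    rw [← map_add, grMul_mk, grMul_mk, grMul_mk, ← map_add]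
    congr 1
    exact Subtype.ext (mul_add _ _ _)
  add_mul {i j} a b c := by
    obtain ⟨a, rfl⟩ := grMk_surjective I i a
    obtain ⟨b, rfl⟩ := grMk_surjective I i b
    obtain ⟨c, rfl⟩ := grMk_surjective I j c
    change grMul I _ _ = grMul I _ _ + grMul I _ _
    rw [← map_add, grMul_mk, grMul_mk, grMul_mk, ← map_add]
    congr 1
    exact Subtype.ext (add_mul _ _ _)
  mul_comm := by
    rintro ⟨i, a⟩ ⟨j, b⟩
    obtain ⟨a, rfl⟩ := grMk_surjective I i a
    obtain ⟨b, rfl⟩ := grMk_surjective I j b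
    exact gradedMk_eq (add_comm i j) _ _ (mul_comm _ _)
  natCast n := grMk I 0 ⟨n, by simp⟩
  natCast_zero := by
    rw [← map_zero (grMk I 0)]
    congr 1
    exact Subtype.ext Nat.cast_zero
  natCast_succ n := by
    change _ = grMk I 0 _ + grMk I 0 _
    rw [← map_add]
    congr 1
    exact Subtype.ext (Nat.cast_succ n)
  intCast n := grMk I 0 ⟨n, by simp⟩
  intCast_ofNat n := by
    congr 1
    exact Subtype.ext (Int.cast_natCast n)
  intCast_negSucc_ofNat n := by
    rw [← map_neg]
    congr 1
    exact Subtype.ext (Int.cast_negSucc n)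

/-- The associated graded ring `gr_I R = ⨁ I ^ l / I ^ (l + 1)`. -/
abbrev Gr (I : Ideal R) : Type _ := ⨁ l, GrPiece I l

/-- The class of `x ∈ I ^ l` in the degree `l` part of `gr_I R`. -/
def grClass (I : Ideal R) (l : ℕ) (x : R) (hx : x ∈ I ^ l) : Gr I :=
  DirectSum.of (GrPiece I) l (grMk I l ⟨x, hx⟩)

/-- The set of homogeneous elements of degree `l` of `gr_I R`. -/
def grDeg (I : Ideal R) (l : ℕ) : Set (Gr I) := Set.range (DirectSum.of (GrPiece I) l)

/-- The ring homomorphism from `R` to `gr_I R` through the degree `0` part `R / I`. -/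
def toGr (I : Ideal R) : R →+* Gr I where
  toFun x := grClass I 0 x (by simp)
  map_one' := rfl
  map_zero' := by
    have : grClass I 0 (0 : R) (by simp) = DirectSum.of (GrPiece I) 0 (grMk I 0 0) := rfl
    rw [this, map_zero, map_zero]
  map_add' x y := by
    unfold grClass
    rw [← map_add, ← map_add]
    rfl
  map_mul' x y := by
    unfold grClass
    rw [DirectSum.of_mul_of]
    rfl

/-- `gr_I R` is an algebra over its degree `0` part `R / I`. -/
instance grAlgebra (I : Ideal R) : Algebra (R ⧸ I) (Gr I) :=
  (Ideal.Quotient.lift I (toGr I) (fun a ha => by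
    change DirectSum.of (GrPiece I) 0 (grMk I 0 _) = 0
    rw [← map_zero (DirectSum.of (GrPiece I) 0), ← map_zero (grMk I 0)]
    congr 1
    rw [grMk_eq_iff]
    simpa using ha)).toAlgebra

/-- For an ideal `A` of `R` and the image `Ī` of `I` in `R / A`, the ring `gr_Ī (R / A)` is an
`R / I`-algebra through the canonical map `R / I → (R / A) / Ī`. -/
instance grQuotientAlgebra (I A : Ideal R) :
    Algebra (R ⧸ I) (Gr (I.map (Ideal.Quotient.mk A))) :=
  ((algebraMap ((R ⧸ A) ⧸ I.map (Ideal.Quotient.mk A)) (Gr (I.map (Ideal.Quotient.mk A)))).comp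
    (Ideal.quotientMap (I.map (Ideal.Quotient.mk A)) (Ideal.Quotient.mk A)
      Ideal.le_comap_map)).toAlgebra

/-- The `I`-order of `p`: the largest `k` with `p ∈ I ^ k`, or `∞`. -/
def ord (I : Ideal R) (p : R) : ℕ∞ := ⨆ k : {k : ℕ // p ∈ I ^ k}, ((k : ℕ) : ℕ∞)

theorem mem_pow_toNat_ord (I : Ideal R) (p : R) : p ∈ I ^ (ord I p).toNat := by
  rcases eq_or_ne (ord I p) ⊤ with h | h
  · simp [h]
  · by_contra hn
    have hle : ∀ k : {k : ℕ // p ∈ I ^ k}, (k : ℕ) + 1 ≤ (ord I p).toNat := by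
      intro k
      by_contra hk
      exact hn (Ideal.pow_le_pow_right (by omega) k.2)
    have h0 : 0 + 1 ≤ (ord I p).toNat := hle ⟨0, by simp⟩
    have hb : ord I p ≤ (((ord I p).toNat - 1 : ℕ) : ℕ∞) := by
      conv_lhs => unfold ord
      refine iSup_le fun k => ?_
      have := hle k
      exact_mod_cast (show (k : ℕ) ≤ (ord I p).toNat - 1 by omega)
    have := ENat.toNat_le_of_le_natCast hb
    omega

open Classical in
/-- The `I`-symbol of `p`: the class of `p` in `I ^ k / I ^ (k + 1)` where `k` is the `I`-order
of `p`. It is meaningful for `p` outside `⋂ I ^ k`, and gets the value `0` otherwise. -/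
def symb (I : Ideal R) (p : R) : Gr I :=
  if p ∈ ⨅ k : ℕ, I ^ k then 0
  else grClass I (ord I p).toNat p (mem_pow_toNat_ord I p)

end Graded

section Strict

variable {R : Type*} [CommRing R]

/-- The monomial `x ^ m = ∏ x_j ^ m_j`. -/
def mon {S : Type*} [CommRing S] {ι : Type*} [Fintype ι] (x : ι → S) (m : ι → ℕ) : S :=
  ∏ j, x j ^ m j

/-- The `R`-linear map `R ^ u → R` with `e_i ↦ a_i`. -/
def rowMap {u : ℕ} (a : Fin u → R) : (Fin u → R) →ₗ[R] R := Fintype.linearCombination R a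

/-- The `I`-filtration `⨁ I ^ (k - d_i)` on `R ^ u` with generators `e_i` in degree `d_i`;
here `I ^ n = R` for `n ≤ 0`, in agreement with truncated subtraction. -/
def shiftedFiltration (I : Ideal R) {u : ℕ} (d : Fin u → ℕ) (k : ℕ) : Submodule R (Fin u → R) :=
  Submodule.pi Set.univ (fun i => I ^ (k - d i))

/-- A linear map `φ` between modules with decreasing filtrations `F` and `G` is strict if
on the image of `φ` the image of `F` and the restriction of `G` coincide. -/
def IsStrict {M N : Type*} [AddCommGroup M] [Module R M] [AddCommGroup N] [Module R N]
    (F : ℕ → Submodule R M) (G : ℕ → Submodule R N) (φ : M →ₗ[R] N) : Prop :=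
  ∀ k, (F k).map φ = G k ⊓ LinearMap.range φ

/-- The ideal generated by a finite family. -/
abbrev idealOf {n : ℕ} (x : Fin n → R) : Ideal R := Ideal.span (Set.range x)

/-- The Rees map `(R / (g))[Y] → gr_g R`, `Y_i ↦ σ_g(g_i)`. -/
def reesMap {s : ℕ} (g : Fin s → R) :
    MvPolynomial (Fin s) (R ⧸ idealOf g) →ₐ[R ⧸ idealOf g] Gr (idealOf g) :=
  MvPolynomial.aeval (fun i => symb (idealOf g) (g i))

/-- The entries `h ^ m_i` of `h ^ M`, where `h = f, g` and `m_i = (k_i, l_i)` are the rows of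
`M = (K L)`. -/
def hM {r s u : ℕ} (f : Fin r → R) (g : Fin s → R)
    (K : Matrix (Fin u) (Fin r) ℕ) (L : Matrix (Fin u) (Fin s) ℕ) (i : Fin u) : R :=
  mon (Sum.elim f g) (Matrix.fromCols K L i)

/-- The ideal of `(R / (g))[Y]` generated by the entries `f̄ ^ k_i * Y ^ l_i`. -/
def polyIdeal {r s u : ℕ} (f : Fin r → R) (g : Fin s → R)
    (K : Matrix (Fin u) (Fin r) ℕ) (L : Matrix (Fin u) (Fin s) ℕ) :
    Ideal (MvPolynomial (Fin s) (R ⧸ idealOf g)) :=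
  idealOf fun i : Fin u =>
    MvPolynomial.C (mon (fun j => Ideal.Quotient.mk (idealOf g) (f j)) (K i)) *
      mon (fun j => MvPolynomial.X j) (L i)

/-- The ideal of `gr_g R` generated by the symbols `σ_g(h ^ m_i)`. -/
def symbIdeal {r s u : ℕ} (f : Fin r → R) (g : Fin s → R)
    (K : Matrix (Fin u) (Fin r) ℕ) (L : Matrix (Fin u) (Fin s) ℕ) : Ideal (Gr (idealOf g)) :=
  idealOf fun i : Fin u => symb (idealOf g) (hM f g K L i)

end Strict

end ReesStrict

end

noncomputable section

namespace ReesStrict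

open MvPolynomial

/-! ### Regular families are quasi-regular -/

section QuasiRegular

variable {R : Type*} [CommRing R] {σ : Type*}

/-! Write `I = ⟨g⟩`. Regularity of `g, f` is used only through quasi-regularity of `g` in `R` and of
`f̄` in `R/I`: a form whose value has higher order than its degree has all coefficients in the
ideal. For `g` this says that the Rees map is injective, hence an isomorphism.

Strictness is proved by raising the order of the coefficients one step at a time. Given `∑ a_i
h^{m_i}` in `I^{k+1}` with `a_i` in `I^{k-|l_i|}`, lift the `a_i` to forms in `Y`. The resulting
form of degree `k` has coefficients in `I`, and each coefficient is a combination of monomials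
`f^{k_i}`. The combination can be rewritten with coefficients in `I` as soon as `I ∩ J = I J` for
every ideal `J` generated by some of these monomials
(`IsQuasiRegular.exists_strict_representation`).

That independence statement (`exists_coeff_mem_of_sum_mon_mem`) follows by induction on the number
of monomials from the colon formula `⟨f̄^{k_i}⟩ : f̄^p = ⟨f̄^{(k_i-p)⁺}⟩` in `R/I`. Completeness
enters there: quasi-regularity gives the formula up to terms of higher order, and successive
approximation removes the error (`IsQuasiRegular.mem_span_of_mul_mon_mem`).

The colon formula also shows that `f̄^{k_i}` is nonzero, so `σ_g(h^{m_i})` is the class in degree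
`|l_i|` and corresponds to `f̄^{k_i} Y^{l_i}` under the Rees map; this is the first isomorphism. For
the second, strictness says that the kernel of `gr_I R → gr (R/⟨h^M⟩)` is generated by these classes
(`ker_grMap_eq_span`). -/

theorem degree_eq_of_coeff_ne_zero {P : MvPolynomial σ R} {n : ℕ} (hP : P.IsHomogeneous n)
    {m : σ →₀ ℕ} (hm : coeff m P ≠ 0) : m.degree = n := by
  by_contra h
  exact hm (hP.coeff_eq_zero h)

theorem coeff_mem_of_add {I : Ideal R} {P Q : MvPolynomial σ R} {m : σ →₀ ℕ}
    (h : coeff m (P - Q) ∈ I) (hQ : coeff m Q ∈ I) : coeff m P ∈ I := by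
  have := I.add_mem h hQ
  rwa [coeff_sub, sub_add_cancel] at this

theorem mem_supported_iff_forall_coeff {P : MvPolynomial σ R} {T : Set σ} :
    P ∈ supported R T ↔ ∀ m, coeff m P ≠ 0 → ∀ j, m j ≠ 0 → j ∈ T := by
  rw [mem_supported]
  constructor
  · intro h m hm j hj
    exact h ((mem_vars_iff_mem_support j).2 ⟨m, mem_support_iff.2 hm, Finsupp.mem_support_iff.2 hj⟩)
  · intro h j hj
    obtain ⟨m, hm, hmj⟩ := (mem_vars_iff_mem_support j).1 hj
    exact h m (mem_support_iff.1 hm) j (Finsupp.mem_support_iff.1 hmj)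

theorem exists_homogeneous_supported_of_mem_pow (x : σ → R) (T : Set σ) {n : ℕ} {y : R}
    (hy : y ∈ Ideal.span (x '' T) ^ n) :
    ∃ P : MvPolynomial σ R, P.IsHomogeneous n ∧ P ∈ supported R T ∧ eval x P = y := by
  rw [Set.image_eq_range, Ideal.mem_span_pow_iff_exists_isHomogeneous] at hy
  obtain ⟨p, hp, rfl⟩ := hy
  refine ⟨rename Subtype.val p, hp.rename_isHomogeneous, ?_, ?_⟩
  · rw [supported_eq_range_rename]
    exact ⟨p, rfl⟩
  · rw [eval_rename]
    rfl

/-- Since `I^(n+1) = I * I^n`, one factor can be kept in the coefficients. Subtracting such a form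
turns "value in `I^(n+1)`" into "value zero" without changing the coefficients modulo `I`. -/
theorem exists_homogeneous_coeff_mem_of_mem_pow (x : σ → R) (T : Set σ) {n : ℕ} {y : R}
    (hy : y ∈ Ideal.span (x '' T) ^ (n + 1)) :
    ∃ P : MvPolynomial σ R, P.IsHomogeneous n ∧ P ∈ supported R T ∧
      (∀ m, coeff m P ∈ Ideal.span (x '' T)) ∧ eval x P = y := by
  rw [pow_succ'] at hy
  refine Submodule.mul_induction_on hy ?_ ?_
  · intro a ha b hb
    obtain ⟨P, h1, h2, rfl⟩ := exists_homogeneous_supported_of_mem_pow x T hb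
    refine ⟨C a * P, h1.C_mul a, mul_mem (Subalgebra.algebraMap_mem _ a) h2, fun m => ?_, by simp⟩
    rw [coeff_C_mul]
    exact Ideal.mul_mem_right _ _ ha
  · rintro _ _ ⟨P, h1, h2, h3, rfl⟩ ⟨Q, k1, k2, k3, rfl⟩
    refine ⟨P + Q, h1.add k1, add_mem h2 k2, fun m => ?_, by simp⟩
    rw [coeff_add]
    exact add_mem (h3 m) (k3 m)

theorem prod_mem_pow_degree {I : Ideal R} {x : σ → R} (m : σ →₀ ℕ)
    (hx : ∀ j, m j ≠ 0 → x j ∈ I) : (m.prod fun j k => x j ^ k) ∈ I ^ m.degree := by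
  rw [Finsupp.degree_apply, ← Finset.prod_pow_eq_pow_sum]
  exact Ideal.prod_mem_prod fun j hj => Ideal.pow_mem_pow (hx j (Finsupp.mem_support_iff.1 hj)) _

theorem eval_mem_mul_pow {J I : Ideal R} {x : σ → R} {n : ℕ} {P : MvPolynomial σ R}
    (hP : P.IsHomogeneous n) (hx : ∀ m, coeff m P ≠ 0 → ∀ j, m j ≠ 0 → x j ∈ I)
    (hJ : ∀ m, coeff m P ∈ J) : eval x P ∈ J * I ^ n := by
  rw [eval_eq]
  refine Ideal.sum_mem _ fun m hm => Ideal.mul_mem_mul (hJ m) ?_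
  have := prod_mem_pow_degree (x := x) (I := I) m (hx m (mem_support_iff.1 hm))
  rwa [show m.degree = n from
    degree_eq_of_coeff_ne_zero hP (mem_support_iff.1 hm)] at this

theorem eval_mem_pow_of_supported {x : σ → R} {T : Set σ} {n : ℕ} {P : MvPolynomial σ R}
    (hP : P.IsHomogeneous n) (hT : P ∈ supported R T) :
    eval x P ∈ Ideal.span (x '' T) ^ n := by
  have := eval_mem_mul_pow (J := ⊤) (I := Ideal.span (x '' T)) (x := x) hP
    (fun m hm j hj => Ideal.subset_span ⟨j, mem_supported_iff_forall_coeff.1 hT m hm j hj, rfl⟩)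
    (fun _ => trivial)
  rwa [← Ideal.one_eq_top, one_mul] at this

/-- The part of the family `x` indexed by `T` has only relations with coefficients in the ideal
it generates. -/
def IsQuasiRegularOn (x : σ → R) (T : Set σ) : Prop :=
  ∀ (n : ℕ) (P : MvPolynomial σ R), P.IsHomogeneous n → P ∈ supported R T → eval x P = 0 →
    ∀ m, coeff m P ∈ Ideal.span (x '' T)

/-- A family `x` is quasi-regular if a form of degree `n` with value in `⟨x⟩ ^ (n + 1)` at `x` has
all its coefficients in `⟨x⟩`. -/
def IsQuasiRegular (x : σ → R) : Prop :=
  ∀ (n : ℕ) (P : MvPolynomial σ R), P.IsHomogeneous n →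
    eval x P ∈ Ideal.span (Set.range x) ^ (n + 1) → ∀ m, coeff m P ∈ Ideal.span (Set.range x)

theorem IsQuasiRegularOn.isQuasiRegular {x : σ → R} (h : IsQuasiRegularOn x Set.univ) :
    IsQuasiRegular x := by
  intro n P hP hx m
  rw [← Set.image_univ] at hx ⊢
  obtain ⟨Q, h1, h2, h3, h4⟩ := exists_homogeneous_coeff_mem_of_mem_pow x _ hx
  refine coeff_mem_of_add (h n (P - Q) (hP.sub h1) ?_ ?_ m) (h3 m)
  · simp [supported_univ]
  · rw [map_sub, h4, sub_self]

theorem isQuasiRegularOn_empty (x : σ → R) : IsQuasiRegularOn x ∅ := by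
  intro n P _ hT h0 m
  rw [supported_empty] at hT
  obtain ⟨c, rfl⟩ := Algebra.mem_bot.1 hT
  rw [algebraMap_eq, eval_C] at h0
  simp [h0]

/-- Cancellation of `a` modulo the ideal passes to its powers: if `y = P(x)` and `a y = Q(x)` with
`Q` having coefficients in the ideal, then `a P - Q` is a relation, so `a` times each coefficient of
`P` lies in the ideal and `a` cancels there. -/
theorem IsQuasiRegularOn.mem_pow_of_mul_mem_pow {x : σ → R} {T : Set σ}
    (hT : IsQuasiRegularOn x T) {a : R}
    (ha : ∀ y, a * y ∈ Ideal.span (x '' T) → y ∈ Ideal.span (x '' T)) (n : ℕ) (y : R)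
    (hy : a * y ∈ Ideal.span (x '' T) ^ n) : y ∈ Ideal.span (x '' T) ^ n := by
  induction n with
  | zero => simp
  | succ n ih =>
    obtain ⟨P, h1, h2, rfl⟩ := exists_homogeneous_supported_of_mem_pow x T
      (ih (Ideal.pow_le_pow_right n.le_succ hy))
    obtain ⟨Q, k1, k2, k3, k4⟩ := exists_homogeneous_coeff_mem_of_mem_pow x T hy
    have key := hT n (C a * P - Q) ((h1.C_mul a).sub k1)
      (sub_mem (mul_mem (Subalgebra.algebraMap_mem _ a) h2) k2) (by simp [k4])
    rw [pow_succ']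
    refine eval_mem_mul_pow h1 (fun m hm j hj => Ideal.subset_span
      ⟨j, mem_supported_iff_forall_coeff.1 h2 m hm j hj, rfl⟩) fun m => ha _ ?_
    have := coeff_mem_of_add (key m) (k3 m)
    rwa [coeff_C_mul] at this

/-- Split a relation as `P = G + X_j H` with `G` free of `X_j`, and induct on the degree to treat
`H`. -/
theorem isQuasiRegularOn_insert {x : σ → R} {T : Set σ} (hT : IsQuasiRegularOn x T) {j : σ}
    (hj : ∀ y, x j * y ∈ Ideal.span (x '' T) → y ∈ Ideal.span (x '' T)) :
    IsQuasiRegularOn x (insert j T) := by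
  classical
  have hle : Ideal.span (x '' T) ≤ Ideal.span (x '' insert j T) :=
    Ideal.span_mono (Set.image_mono (Set.subset_insert j T))
  have hxj : x j ∈ Ideal.span (x '' insert j T) :=
    Ideal.subset_span ⟨j, Set.mem_insert j T, rfl⟩
  have hsup : supported R T ≤ supported R (insert j T) := supported_mono (Set.subset_insert j T)
  intro n
  induction n with
  | zero =>
    intro P hP _ h0 m
    rw [← totalDegree_zero_iff_isHomogeneous, totalDegree_eq_zero_iff_eq_C] at hP
    rw [hP, eval_C] at h0
    rw [hP, h0]
    simp
  | succ n ih =>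
    intro P hP hS h0
    set G := P.modMonomial (Finsupp.single j 1) with hG
    set H := P.divMonomial (Finsupp.single j 1) with hH
    have hPGH : G + X j * H = P := modMonomial_add_divMonomial_single P j
    have hGc : ∀ m, coeff m G = if m j = 0 then coeff m P else 0 := by
      intro m
      split_ifs with hm
      · exact coeff_modMonomial_of_not_le P fun hle' => by
          have := hle' j
          simp [hm] at this
      · refine coeff_modMonomial_of_le P ?_
        rw [Finsupp.single_le_iff]
        omega
    have hHc : ∀ m, coeff m H = coeff (Finsupp.single j 1 + m) P := coeff_divMonomial _ P
    have hGh : G.IsHomogeneous (n + 1) := by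
      intro m hm
      rw [hGc] at hm
      split_ifs at hm with h
      · exact hP hm
      · exact absurd rfl hm
    have hGs : G ∈ supported R T := by
      rw [mem_supported_iff_forall_coeff] at hS ⊢
      intro m hm i hi
      rw [hGc] at hm
      split_ifs at hm with h
      · rcases hS m hm i hi with rfl | h'
        · exact absurd h hi
        · exact h'
      · exact absurd rfl hm
    have hHh : H.IsHomogeneous n := by
      intro m hm
      rw [hHc] at hm
      have := degree_eq_of_coeff_ne_zero hP hm
      rw [map_add, Finsupp.degree_single] at this
      refine (DFunLike.congr_fun Finsupp.degree_eq_weight_one m).symm.trans ?_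
      omega
    have hHs : H ∈ supported R (insert j T) := by
      rw [mem_supported_iff_forall_coeff] at hS ⊢
      intro m hm i hi
      rw [hHc] at hm
      exact hS _ hm i (by simp [hi])
    -- `x_j H(x) = -G(x)` lies in the power `n + 1`, and `x_j` cancels modulo powers.
    have hHx : eval x H ∈ Ideal.span (x '' T) ^ (n + 1) := by
      refine hT.mem_pow_of_mul_mem_pow hj _ _ ?_
      have e : x j * eval x H = - eval x G := by
        rw [eq_neg_iff_add_eq_zero, ← h0, ← hPGH, map_add, map_mul, eval_X, add_comm]
      rw [e]
      exact neg_mem (eval_mem_pow_of_supported hGh hGs)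
    have hHI : ∀ m, coeff m H ∈ Ideal.span (x '' insert j T) := by
      obtain ⟨Q, k1, k2, k3, k4⟩ := exists_homogeneous_coeff_mem_of_mem_pow x T hHx
      exact fun m => coeff_mem_of_add (ih (H - Q) (hHh.sub k1) (sub_mem hHs (hsup k2))
        (by rw [map_sub, k4, sub_self]) m) (hle (k3 m))
    -- Replacing `H(x)` by the value of a form `h` of degree `n + 1` over `T` makes `G + x_j h` a
    -- relation over `T` alone.
    have hGI : ∀ m, coeff m G ∈ Ideal.span (x '' insert j T) := by
      obtain ⟨h, k1, k2, k3⟩ := exists_homogeneous_supported_of_mem_pow x T hHx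
      intro m
      have := hT (n + 1) (G + C (x j) * h) (hGh.add (k1.C_mul _))
        (add_mem hGs (mul_mem (Subalgebra.algebraMap_mem _ _) k2))
        (by rw [map_add, map_mul, eval_C, k3, ← h0, ← hPGH, map_add, map_mul, eval_X]) m
      rw [coeff_add, coeff_C_mul] at this
      exact (Ideal.add_mem_iff_left _ (Ideal.mul_mem_right _ _ hxj)).1 (hle this)
    intro m
    rw [← hPGH, coeff_add, coeff_X_mul']
    refine add_mem (hGI m) ?_
    split_ifs
    · exact hHI _
    · exact zero_mem _

/-- An elementwise form of weak regularity implies quasi-regularity. -/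
theorem isQuasiRegular_of_forall_mem {s : ℕ} (x : Fin s → R)
    (h : ∀ (i : Fin s) (y : R), x i * y ∈ Ideal.span (x '' {j | j < i}) →
      y ∈ Ideal.span (x '' {j | j < i})) : IsQuasiRegular x := by
  have key : ∀ k ≤ s, IsQuasiRegularOn x {j : Fin s | (j : ℕ) < k} := by
    intro k
    induction k with
    | zero => simpa using isQuasiRegularOn_empty x
    | succ k ih =>
      intro hk
      have := isQuasiRegularOn_insert (ih (by omega)) (j := ⟨k, hk⟩) (h ⟨k, hk⟩)
      convert this using 1
      ext j
      simp [Fin.ext_iff]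
      omega
  refine IsQuasiRegularOn.isQuasiRegular ?_
  convert key s le_rfl using 1
  ext j
  simp

end QuasiRegular

/-! ### Translation from regular sequences given as lists -/

section Lists

variable {R : Type*} [CommRing R]

theorem ofList_ofFn {s : ℕ} (x : Fin s → R) : Ideal.ofList (List.ofFn x) = idealOf x := by
  unfold Ideal.ofList idealOf
  congr 1
  ext y
  simp [List.mem_ofFn]

theorem ofList_take_ofFn {s : ℕ} (x : Fin s → R) (i : Fin s) :
    Ideal.ofList ((List.ofFn x).take i) = Ideal.span (x '' {j | j < i}) := by
  unfold Ideal.ofList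
  congr 1
  ext y
  simp only [Set.mem_ofPred_eq, List.mem_take_iff_getElem, List.getElem_ofFn, List.length_ofFn,
    Set.mem_image]
  constructor
  · rintro ⟨j, hj, rfl⟩
    exact ⟨⟨j, by omega⟩, Fin.lt_def.2 (show j < i by omega), rfl⟩
  · rintro ⟨j, hj, rfl⟩
    exact ⟨j, by have := Fin.lt_def.1 hj; omega, rfl⟩

theorem mem_ofList_take_of_mul_mem {l : List R} (h : RingTheory.Sequence.IsWeaklyRegular R l)
    {i : ℕ} (hi : i < l.length) {y : R} (hy : l[i] * y ∈ Ideal.ofList (l.take i)) :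
    y ∈ Ideal.ofList (l.take i) := by
  have h1 := h.regular_mod_prev i hi
  rw [isSMulRegular_quotient_iff_mem_of_smul_mem] at h1
  simpa using h1 y (by simpa using hy)

theorem isQuasiRegular_of_isWeaklyRegular {s : ℕ} (x : Fin s → R)
    (h : RingTheory.Sequence.IsWeaklyRegular R (List.ofFn x)) : IsQuasiRegular x := by
  refine isQuasiRegular_of_forall_mem x fun i y hy => ?_
  have := mem_ofList_take_of_mul_mem h (i := i) (by simp) (y := y)
  rw [ofList_take_ofFn] at this
  exact this (by simpa using hy)

theorem isQuasiRegular_mk_of_isWeaklyRegular_append {s r : ℕ} (g : Fin s → R) (f : Fin r → R)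
    (h : RingTheory.Sequence.IsWeaklyRegular R (List.ofFn g ++ List.ofFn f)) :
    IsQuasiRegular fun j => Ideal.Quotient.mk (idealOf g) (f j) := by
  refine isQuasiRegular_of_forall_mem _ fun i y hy => ?_
  obtain ⟨y, rfl⟩ := Ideal.Quotient.mk_surjective y
  have e : Ideal.span ((fun j => Ideal.Quotient.mk (idealOf g) (f j)) '' {j | j < i}) =
      (Ideal.span (f '' {j | j < i})).map (Ideal.Quotient.mk (idealOf g)) := by
    rw [Ideal.map_span, Set.image_image]
  rw [e, ← map_mul, Ideal.mem_quotient_iff_mem_sup] at hy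
  rw [e, Ideal.mem_quotient_iff_mem_sup]
  have hI : Ideal.ofList ((List.ofFn g ++ List.ofFn f).take (s + i)) =
      Ideal.span (f '' {j | j < i}) ⊔ idealOf g := by
    rw [List.take_append, List.length_ofFn, Nat.add_sub_cancel_left, Ideal.ofList_append,
      ofList_take_ofFn, List.take_of_length_le (by simp), ofList_ofFn, sup_comm]
  have := mem_ofList_take_of_mul_mem h (i := s + i) (by simp) (y := y)
  rw [hI] at this
  exact this (by simpa [List.getElem_append] using hy)

end Lists

/-! ### Monomials in a finite family -/

section Monomials

variable {R : Type*} [CommRing R] {σ : Type*} [Fintype σ]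

theorem mon_add (x : σ → R) (m n : σ → ℕ) : mon x (m + n) = mon x m * mon x n := by
  simp [mon, pow_add, Finset.prod_mul_distrib]

theorem eval_monomial_eq_mon (x : σ → R) (m : σ →₀ ℕ) (c : R) :
    eval x (monomial m c) = c * mon x m := by
  rw [eval_monomial, Finsupp.prod_fintype _ _ (by simp)]
  rfl

theorem eval_eq_sum_mon (x : σ → R) (P : MvPolynomial σ R) :
    eval x P = ∑ m ∈ P.support, coeff m P * mon x m := by
  conv_lhs => rw [P.as_sum, map_sum]
  simp_rw [eval_monomial_eq_mon]

theorem map_mon {S : Type*} [CommRing S] (φ : R →+* S) (x : σ → R) (m : σ → ℕ) :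
    φ (mon x m) = mon (fun j => φ (x j)) m := by
  simp [mon]

theorem monomial_eq_C_mul_mon (m : σ →₀ ℕ) (c : R) :
    monomial m c = C c * mon (fun j => (X j : MvPolynomial σ R)) m := by
  rw [monomial_eq, Finsupp.prod_fintype _ _ (by simp)]
  rfl

theorem mon_mem_pow_degree (x : σ → R) (m : σ →₀ ℕ) :
    mon x m ∈ Ideal.span (Set.range x) ^ m.degree := by
  have := prod_mem_pow_degree (x := x) (I := Ideal.span (Set.range x)) m
    fun j _ => Ideal.subset_span ⟨j, rfl⟩
  rwa [Finsupp.prod_fintype _ _ (by simp)] at this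

/-- Both sides are the monomial with exponent `max(m, n)`. -/
theorem mon_mul_tsub_comm (x : σ → R) (m n : σ →₀ ℕ) :
    mon x (m - n : σ →₀ ℕ) * mon x n = mon x (n - m : σ →₀ ℕ) * mon x m := by
  rw [← mon_add, ← mon_add]
  congr 1
  ext j
  simp only [Finsupp.coe_tsub, Pi.add_apply, Pi.sub_apply]
  omega

theorem mon_tsub_mul_of_le (x : σ → R) {m n : σ →₀ ℕ} (h : n ≤ m) :
    mon x (m - n : σ →₀ ℕ) * mon x n = mon x m := by
  rw [← mon_add, ← Finsupp.coe_add, tsub_add_cancel_of_le h]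

end Monomials

/-! ### Strictness by raising the order of the coefficients -/

section Strictness

variable {R : Type*} [CommRing R] {σ ι : Type*} [Fintype σ] [Fintype ι]

/-- Strictness of the map with values `b i * x ^ l i` at a quasi-regular family `x`, provided that
`⟨x⟩ ∩ ⟨b i : i ∈ S⟩ = ⟨x⟩ * ⟨b i : i ∈ S⟩` for all `S`. -/
theorem IsQuasiRegular.exists_strict_representation {x : σ → R} (hx : IsQuasiRegular x)
    (b : ι → R) (l : ι → σ →₀ ℕ)
    (hb : ∀ (S : Finset ι) (c : ι → R), ∑ i ∈ S, c i * b i ∈ Ideal.span (Set.range x) →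
      ∃ ε : ι → R, (∀ i, ε i ∈ Ideal.span (Set.range x)) ∧
        ∑ i ∈ S, ε i * b i = ∑ i ∈ S, c i * b i)
    (k : ℕ) (a : ι → R) (ha : ∑ i, a i * (b i * mon x (l i)) ∈ Ideal.span (Set.range x) ^ k) :
    ∃ a' : ι → R, (∀ i, a' i ∈ Ideal.span (Set.range x) ^ (k - (l i).degree)) ∧
      ∑ i, a' i * (b i * mon x (l i)) = ∑ i, a i * (b i * mon x (l i)) := by
  classical
  set I := Ideal.span (Set.range x) with hI
  induction k generalizing a with
  | zero => exact ⟨a, by simp, rfl⟩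
  | succ k ih =>
    obtain ⟨a, haI, hsum⟩ := ih a (Ideal.pow_le_pow_right k.le_succ ha)
    rw [← hsum] at ha ⊢
    choose P hP hPx using fun i => (Ideal.mem_span_pow_iff_exists_isHomogeneous x _).1 (haI i)
    -- The other indices contribute elements of `I^(k+1)` whatever their coefficients, so only these
    -- matter.
    set S : Finset ι := Finset.univ.filter fun i => (l i).degree ≤ k with hS
    set Q : MvPolynomial σ R := ∑ i ∈ S, P i * monomial (l i) (b i) with hQ
    have hQh : Q.IsHomogeneous k := by
      refine IsHomogeneous.sum _ _ _ fun i hi => ?_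
      have hi' : (l i).degree ≤ k := (Finset.mem_filter.1 hi).2
      have := (hP i).mul (isHomogeneous_monomial (b i) (rfl : (l i).degree = _))
      rwa [Nat.sub_add_cancel hi'] at this
    have hQx : eval x Q = ∑ i ∈ S, a i * (b i * mon x (l i)) := by
      rw [hQ, map_sum]
      exact Finset.sum_congr rfl fun i _ => by rw [map_mul, hPx, eval_monomial_eq_mon]
    have hrest : ∑ i ∈ Finset.univ.filter (fun i => ¬ (l i).degree ≤ k),
        a i * (b i * mon x (l i)) ∈ I ^ (k + 1) := by
      refine Ideal.sum_mem _ fun i hi => Ideal.mul_mem_left _ _ (Ideal.mul_mem_left _ _ ?_)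
      exact Ideal.pow_le_pow_right (not_le.1 (Finset.mem_filter.1 hi).2) (mon_mem_pow_degree x _)
    have hsplit := Finset.sum_filter_add_sum_filter_not Finset.univ
      (fun i => (l i).degree ≤ k) fun i => a i * (b i * mon x (l i))
    have hQI : ∀ β, coeff β Q ∈ I := hx k Q hQh (by
      rw [hQx]
      rw [← hsplit] at ha
      exact (Ideal.add_mem_iff_left _ hrest).1 ha)
    have hcoeff : ∀ β, coeff β Q =
        ∑ i ∈ S.filter (fun i => l i ≤ β), coeff (β - l i) (P i) * b i := by
      intro β
      rw [hQ, coeff_sum, Finset.sum_filter (fun i => l i ≤ β)]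
      exact Finset.sum_congr rfl fun i _ => by rw [coeff_mul_monomial']
    -- Each coefficient of `Q` is a combination of the `b i` lying in `I`, so `hb` rewrites it with
    -- coefficients in `I`; the new `a' i` collects these over all `β`.
    choose ε hε hεsum using fun β => hb (S.filter fun i => l i ≤ β)
      (fun i => coeff (β - l i) (P i)) (by rw [← hcoeff]; exact hQI β)
    refine ⟨fun i => if (l i).degree ≤ k then
      ∑ β ∈ Q.support.filter (fun β => l i ≤ β), ε β i * mon x (β - l i : σ →₀ ℕ) else a i,
      fun i => ?_, ?_⟩
    · simp only
      split_ifs with hi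
      · refine Ideal.sum_mem _ fun β hβ => ?_
        rw [Finset.mem_filter, mem_support_iff] at hβ
        have hdeg : k - (l i).degree = (β - l i).degree := by
          have h1 := degree_eq_of_coeff_ne_zero hQh hβ.1
          have h2 : (β - l i).degree + (l i).degree = β.degree := by
            rw [← map_add, tsub_add_cancel_of_le hβ.2]
          omega
        rw [Nat.succ_sub hi, pow_succ', hdeg]
        exact Ideal.mul_mem_mul (hε β i) (mon_mem_pow_degree x _)
      · rw [Nat.sub_eq_zero_of_le (by omega)]
        simp
    · rw [← hsplit, ← Finset.sum_filter_add_sum_filter_not Finset.univ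
        (fun i => (l i).degree ≤ k), ← hS, ← hQx]
      congr 1
      · rw [eval_eq_sum_mon]
        have h1 : ∀ i ∈ S, (if (l i).degree ≤ k then
            ∑ β ∈ Q.support.filter (fun β => l i ≤ β), ε β i * mon x (β - l i : σ →₀ ℕ)
            else a i) * (b i * mon x (l i)) =
            ∑ β ∈ Q.support, if l i ≤ β then ε β i * b i * mon x β else 0 := by
          intro i hi
          rw [if_pos (Finset.mem_filter.1 hi).2, Finset.sum_mul, Finset.sum_filter]
          refine Finset.sum_congr rfl fun β _ => ?_
          split_ifs with h
          · rw [← mon_tsub_mul_of_le x h]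
            ring
          · rfl
        rw [Finset.sum_congr rfl h1, Finset.sum_comm]
        refine Finset.sum_congr rfl fun β _ => ?_
        rw [hcoeff, ← hεsum, Finset.sum_mul, Finset.sum_filter (fun i => l i ≤ β)]
      · exact Finset.sum_congr rfl fun i hi => by simp only [if_neg (Finset.mem_filter.1 hi).2]

theorem IsQuasiRegular.exists_strict_representation_mon {x : σ → R} (hx : IsQuasiRegular x)
    (l : ι → σ →₀ ℕ) (k : ℕ) (a : ι → R)
    (ha : ∑ i, a i * mon x (l i) ∈ Ideal.span (Set.range x) ^ k) :
    ∃ a' : ι → R, (∀ i, a' i ∈ Ideal.span (Set.range x) ^ (k - (l i).degree)) ∧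
      ∑ i, a' i * mon x (l i) = ∑ i, a i * mon x (l i) := by
  classical
  have := hx.exists_strict_representation (fun _ : ι => 1) l (fun S c hc => ?_) k a (by simpa)
  · simpa using this
  · rcases S.eq_empty_or_nonempty with rfl | ⟨i, hi⟩
    · exact ⟨0, by simp, by simp⟩
    -- With all `b i = 1`, the whole sum, which lies in the ideal, can be placed at one index.
    · refine ⟨Pi.single i (∑ i ∈ S, c i), fun j => ?_, ?_⟩
      · rcases eq_or_ne j i with rfl | h
        · simpa using hc
        · simp [h]
      · simp [hi]

end Strictness

/-! ### The colon formula in a complete ring -/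

section Complete

variable {A : Type*} [CommRing A] {σ ι : Type*} [Fintype σ] [Fintype ι]

/-- Successive approximation of an element of a finitely generated ideal in a complete ring. -/
theorem mem_span_of_forall_exists_approximation {F : Ideal A} [IsAdicComplete F A] (y : ι → A)
    (d : ℕ) (W : A → Prop)
    (step : ∀ (n : ℕ) (x : A), x ∈ F ^ n → W x → ∃ q : ι → A, (∀ i, q i ∈ F ^ (n - d)) ∧
      x - ∑ i, q i * y i ∈ F ^ (n + 1) ∧ W (x - ∑ i, q i * y i))
    {x : A} (hx : W x) : x ∈ Ideal.span (Set.range y) := by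
  have step' : ∀ (n : ℕ) (x : {x : A // x ∈ F ^ n ∧ W x}), ∃ q : ι → A,
      (∀ i, q i ∈ F ^ (n - d)) ∧ x.1 - ∑ i, q i * y i ∈ F ^ (n + 1) ∧ W (x.1 - ∑ i, q i * y i) :=
    fun n x => step n x.1 x.2.1 x.2.2
  choose q hq hqF hqW using step'
  -- `X n` is the remainder after `n` corrections, and `Q n` below is the sum of the corrections
  -- made so far.
  let X : ∀ n : ℕ, {x : A // x ∈ F ^ n ∧ W x} := fun n =>
    Nat.rec ⟨x, by simp, hx⟩ (fun n z => ⟨z.1 - ∑ i, q n z i * y i, hqF n z, hqW n z⟩) n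
  let Q : ℕ → ι → A := fun N i => ∑ n ∈ Finset.range N, q n (X n) i
  have hX : ∀ n, (X n).1 = x - ∑ i, Q n i * y i := by
    intro n
    induction n with
    | zero => simp [Q, X]
    | succ n ih =>
      change (X n).1 - ∑ i, q n (X n) i * y i = _
      rw [ih, sub_sub, ← Finset.sum_add_distrib]
      simp [Q, Finset.sum_range_succ, add_mul]
  -- Corrections at stage `n` lie only in `F^(n-d)`; shifting the index by `d` compensates for this
  -- loss.
  have hcauchy : ∀ i {m n : ℕ}, m ≤ n →
      Q (m + d) i ≡ Q (n + d) i [SMOD (F ^ m • ⊤ : Submodule A A)] := by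
    intro i m n hmn
    rw [SModEq.comm, SModEq.sub_mem, smul_eq_mul, Ideal.mul_top]
    rw [Finset.sum_range_sub_sum_range (by omega)]
    refine Ideal.sum_mem _ fun k hk => Ideal.pow_le_pow_right ?_ (hq k (X k) i)
    simp at hk
    omega
  choose L hL using fun i => IsPrecomplete.prec' (I := F) (fun n => Q (n + d) i) (hcauchy i)
  have h0 : x - ∑ i, L i * y i = 0 := by
    refine IsHausdorff.haus' (I := F) _ fun n => ?_
    rw [SModEq.sub_mem, sub_zero, smul_eq_mul, Ideal.mul_top]
    have e : x - ∑ i, L i * y i = (X (n + d)).1 + ∑ i, (Q (n + d) i - L i) * y i := by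
      rw [hX]
      simp_rw [sub_mul, Finset.sum_sub_distrib]
      ring
    rw [e]
    refine add_mem (Ideal.pow_le_pow_right (by omega) (X (n + d)).2.1)
      (Ideal.sum_mem _ fun i _ => Ideal.mul_mem_right _ _ ?_)
    have := hL i n
    rwa [SModEq.sub_mem, smul_eq_mul, Ideal.mul_top] at this
  rw [sub_eq_zero.1 h0]
  exact Ideal.sum_mem _ fun i _ => Ideal.mul_mem_left _ _ (Ideal.subset_span ⟨i, rfl⟩)

/-- The colon formula for monomial ideals in a quasi-regular family. -/
theorem IsQuasiRegular.mem_span_of_mul_mon_mem {f : σ → A} (hf : IsQuasiRegular f)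
    [IsAdicComplete (Ideal.span (Set.range f)) A] (k : ι → σ →₀ ℕ) (p : σ →₀ ℕ) {x : A}
    (hx : x * mon f p ∈ Ideal.span (Set.range fun i => mon f (k i))) :
    x ∈ Ideal.span (Set.range fun i => mon f (k i - p : σ →₀ ℕ)) := by
  classical
  refine mem_span_of_forall_exists_approximation (F := Ideal.span (Set.range f)) _
    -- A crude uniform bound on the degrees of the generators suffices for the loss of order.
    (∑ i, (k i - p).degree)
    (fun x => x * mon f p ∈ Ideal.span (Set.range fun i => mon f (k i))) ?_ hx
  intro n x hxn hx
  set F := Ideal.span (Set.range f) with hF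
  obtain ⟨c, hc⟩ := (Ideal.mem_span_range_iff_exists_fun).1 hx
  have hmem : x * mon f p ∈ F ^ (n + p.degree) := by
    rw [pow_add]
    exact Ideal.mul_mem_mul hxn (mon_mem_pow_degree f p)
  obtain ⟨c, hcF, hc⟩ : ∃ c : ι → A, (∀ i, c i ∈ F ^ (n + p.degree - (k i).degree)) ∧
      ∑ i, c i * mon f (k i) = x * mon f p := by
    obtain ⟨c', h1, h2⟩ := hf.exists_strict_representation_mon k (n + p.degree) c (by rwa [hc])
    exact ⟨c', h1, h2.trans hc⟩
  obtain ⟨P, hP, hPx⟩ := (Ideal.mem_span_pow_iff_exists_isHomogeneous f _).1 hxn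
  choose C' hC hCx using fun i => (Ideal.mem_span_pow_iff_exists_isHomogeneous f _).1 (hcF i)
  set S : Finset ι := Finset.univ.filter fun i => (k i).degree ≤ n + p.degree with hS
  -- `D` is the part of degree `n + |p|` of the relation `x f^p = ∑ c_i f^{k_i}`; its value is a sum
  -- of terms of higher order.
  set D : MvPolynomial σ A := P * monomial p 1 - ∑ i ∈ S, C' i * monomial (k i) 1 with hD
  have hDh : D.IsHomogeneous (n + p.degree) := by
    refine (hP.mul (isHomogeneous_monomial _ rfl)).sub (IsHomogeneous.sum _ _ _ fun i hi => ?_)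
    have := (hC i).mul (isHomogeneous_monomial (1 : A) (rfl : (k i).degree = _))
    rwa [Nat.sub_add_cancel (Finset.mem_filter.1 hi).2] at this
  have hDx : eval f D ∈ F ^ (n + p.degree + 1) := by
    have e : eval f D = ∑ i ∈ Finset.univ.filter (fun i => ¬ (k i).degree ≤ n + p.degree),
        c i * mon f (k i) := by
      rw [hD, map_sub, map_mul, map_sum, hPx, eval_monomial_eq_mon, one_mul, ← hc,
        ← Finset.sum_filter_add_sum_filter_not Finset.univ
          (fun i => (k i).degree ≤ n + p.degree), ← hS, add_comm, add_sub_assoc, sub_eq_zero.2,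
        add_zero]
      exact Finset.sum_congr rfl fun i _ => by
        rw [map_mul, hCx, eval_monomial_eq_mon, one_mul]
    rw [e]
    refine Ideal.sum_mem _ fun i hi => Ideal.mul_mem_left _ _ ?_
    exact Ideal.pow_le_pow_right (not_le.1 (Finset.mem_filter.1 hi).2) (mon_mem_pow_degree f _)
  have hDI := hf _ D hDh hDx
  -- At `α + p` no summand of the second sum contributes, so the coefficient of `D` there is that of
  -- `P` at `α`. Such terms of `x` are of higher order and need no correction; every other term is
  -- divisible by some `f^{(k_i-p)⁺}`.
  have hα : ∀ α, (∀ i, ¬ k i ≤ α + p) → coeff α P ∈ F := by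
    intro α h
    have := hDI (α + p)
    rw [hD, coeff_sub, coeff_mul_monomial, coeff_sum, Finset.sum_eq_zero, sub_zero, mul_one]
      at this
    · exact this
    · intro i _
      rw [coeff_mul_monomial', if_neg (h i)]
  have hterm : ∀ α ∈ P.support, ∃ q : ι → A,
      (∀ i, q i ∈ F ^ (n - ∑ i, (k i - p).degree)) ∧
      coeff α P * mon f α - ∑ i, q i * mon f (k i - p : σ →₀ ℕ) ∈ F ^ (n + 1) := by
    intro α hαs
    have hdeg := degree_eq_of_coeff_ne_zero hP (mem_support_iff.1 hαs)
    by_cases h : ∃ i, k i ≤ α + p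
    · obtain ⟨i, hi⟩ := h
      have hle : k i - p ≤ α := tsub_le_iff_right.2 hi
      refine ⟨Pi.single i (coeff α P * mon f (α - (k i - p) : σ →₀ ℕ)), fun j => ?_, ?_⟩
      · rcases eq_or_ne j i with rfl | hj
        · rw [Pi.single_eq_same]
          refine Ideal.mul_mem_left _ _ (Ideal.pow_le_pow_right ?_ (mon_mem_pow_degree f _))
          have h1 : (α - (k j - p)).degree + (k j - p).degree = α.degree := by
            rw [← map_add, tsub_add_cancel_of_le hle]
          have h2 := Finset.single_le_sum (f := fun i => (k i - p).degree)
            (fun _ _ => Nat.zero_le _) (Finset.mem_univ j)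
          omega
        · simp [hj]
      · rw [Finset.sum_eq_single i (fun j _ hj => by simp [hj]) (by simp), Pi.single_eq_same,
          mul_assoc, mon_tsub_mul_of_le f hle, sub_self]
        exact zero_mem _
    · push Not at h
      refine ⟨0, by simp, ?_⟩
      simp only [Pi.zero_apply, zero_mul, Finset.sum_const_zero, sub_zero]
      rw [pow_succ', ← hdeg]
      exact Ideal.mul_mem_mul (hα α h) (mon_mem_pow_degree f α)
  choose! q hqF hq using hterm
  refine ⟨fun i => ∑ α ∈ P.support, q α i, fun i => Ideal.sum_mem _ fun α h => hqF α h i, ?_, ?_⟩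
  · rw [← hPx, eval_eq_sum_mon]
    simp_rw [Finset.sum_mul]
    rw [Finset.sum_comm, ← Finset.sum_sub_distrib]
    exact Ideal.sum_mem _ hq
  · rw [sub_mul]
    refine sub_mem hx ?_
    rw [Finset.sum_mul]
    refine Ideal.sum_mem _ fun i _ => ?_
    rw [mul_assoc, mon_mul_tsub_comm]
    exact Ideal.mul_mem_left _ _ (Ideal.mul_mem_left _ _ (Ideal.subset_span ⟨i, rfl⟩))

end Complete

/-! ### Independence of monomials in `f` from the ideal `I` -/

section Independence

variable {R : Type*} [CommRing R] {σ ι : Type*} [Fintype σ]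

/-- If the family `f` is quasi-regular in `R / I` and `R / I` is complete, then
`I ∩ J = I * J` for each ideal `J` generated by monomials in `f`. -/
theorem exists_coeff_mem_of_sum_mon_mem {I : Ideal R} {f : σ → R}
    (hf : IsQuasiRegular fun j => Ideal.Quotient.mk I (f j))
    [IsAdicComplete (Ideal.span (Set.range fun j => Ideal.Quotient.mk I (f j))) (R ⧸ I)]
    (k : ι → σ →₀ ℕ) (S : Finset ι) (c : ι → R) (hc : ∑ i ∈ S, c i * mon f (k i) ∈ I) :
    ∃ ε : ι → R, (∀ i, ε i ∈ I) ∧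
      ∑ i ∈ S, ε i * mon f (k i) = ∑ i ∈ S, c i * mon f (k i) := by
  classical
  induction S using Finset.induction_on generalizing c with
  | empty => exact ⟨0, by simp, by simp⟩
  | insert j S hj ih =>
    -- Modulo `I` the relation puts `c j * f^{k_j}` in the ideal of the remaining monomials, so the
    -- colon formula applies to `c j`.
    have hcol : Ideal.Quotient.mk I (c j) ∈ Ideal.span (Set.range fun i : S =>
        mon (fun j => Ideal.Quotient.mk I (f j)) (k i - k j : σ →₀ ℕ)) := by
      refine hf.mem_span_of_mul_mon_mem (fun i : S => k i) (k j) ?_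
      rw [Finset.sum_insert hj] at hc
      have h0 := Ideal.Quotient.eq_zero_iff_mem.2 hc
      rw [map_add, map_mul, map_mon] at h0
      rw [eq_neg_of_add_eq_zero_left h0, neg_mem_iff, map_sum]
      refine Ideal.sum_mem _ fun i hi => ?_
      rw [map_mul, map_mon]
      exact Ideal.mul_mem_left _ _ (Ideal.subset_span ⟨⟨i, hi⟩, rfl⟩)
    obtain ⟨t, ht⟩ := Ideal.mem_span_range_iff_exists_fun.1 hcol
    choose t' ht' using fun i => Ideal.Quotient.mk_surjective (I := I) (t i)
    let T : ι → R := fun i => if h : i ∈ S then t' ⟨i, h⟩ else 0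
    set e : R := c j - ∑ i ∈ S, T i * mon f (k i - k j : σ →₀ ℕ) with he
    have heI : e ∈ I := by
      rw [← Ideal.Quotient.eq_zero_iff_mem, he, map_sub, ← ht, map_sum, sub_eq_zero,
        ← Finset.sum_coe_sort S]
      refine Finset.sum_congr rfl fun i _ => ?_
      rw [map_mul, map_mon, ← ht']
      simp [T]
    -- Apart from `e`, which lies in `I`, the coefficient of `f^{k_j}` is moved to the other
    -- monomials.
    have hcj : c j * mon f (k j) = e * mon f (k j) +
        ∑ i ∈ S, T i * mon f (k j - k i : σ →₀ ℕ) * mon f (k i) := by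
      rw [he, sub_mul, Finset.sum_mul, sub_add_eq_add_sub, add_sub_assoc, sub_eq_zero.2, add_zero]
      exact Finset.sum_congr rfl fun i _ => by
        rw [mul_assoc, mul_assoc, mon_mul_tsub_comm]
    have hsum : ∑ i ∈ insert j S, c i * mon f (k i) = e * mon f (k j) +
        ∑ i ∈ S, (T i * mon f (k j - k i : σ →₀ ℕ) + c i) * mon f (k i) := by
      rw [Finset.sum_insert hj, hcj, add_assoc, ← Finset.sum_add_distrib]
      simp_rw [add_mul]
    rw [hsum] at hc ⊢
    obtain ⟨ε, h1, h2⟩ := ih _ ((Ideal.add_mem_iff_right _ (Ideal.mul_mem_right _ _ heI)).1 hc)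
    refine ⟨Function.update ε j e, fun i => ?_, ?_⟩
    · rcases eq_or_ne i j with rfl | h
      · simpa using heI
      · simpa [h] using h1 i
    · rw [Finset.sum_insert hj, ← h2, Function.update_self]
      congr 1
      refine Finset.sum_congr rfl fun i hi => ?_
      rw [Function.update_of_ne (ne_of_mem_of_not_mem hi hj)]

/-- A monomial in a quasi-regular family of a nontrivial complete ring is nonzero. -/
theorem IsQuasiRegular.mon_ne_zero {A : Type*} [CommRing A] [Nontrivial A] {f : σ → A}
    (hf : IsQuasiRegular f) [IsAdicComplete (Ideal.span (Set.range f)) A] (p : σ →₀ ℕ) :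
    mon f p ≠ 0 := by
  intro h
  -- The colon formula for the empty family: `1 * f^p = 0` would force `1` into the zero ideal.
  have := hf.mem_span_of_mul_mon_mem (fun i : Empty => i.elim) p (x := 1) (by simp [h])
  simp [Set.range_eq_empty] at this

end Independence

/-! ### Classes, orders and symbols in the associated graded ring -/

section Classes

variable {R : Type*} [CommRing R] {I : Ideal R}

theorem grClass_congr {i j : ℕ} {x y : R} (hij : i = j) (hxy : x = y) (hx : x ∈ I ^ i)
    (hy : y ∈ I ^ j) : grClass I i x hx = grClass I j y hy := by
  subst hij hxy
  rfl

theorem grClass_eq_zero_iff {l : ℕ} {x : R} (hx : x ∈ I ^ l) :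
    grClass I l x hx = 0 ↔ x ∈ I ^ (l + 1) := by
  rw [grClass, ← map_zero (DirectSum.of (GrPiece I) l), (DirectSum.of_injective l).eq_iff,
    ← map_zero (grMk I l), grMk_eq_iff]
  simp

theorem grClass_mul {i j : ℕ} {x y : R} (hx : x ∈ I ^ i) (hy : y ∈ I ^ j) :
    grClass I i x hx * grClass I j y hy =
      grClass I (i + j) (x * y) (by rw [pow_add]; exact Ideal.mul_mem_mul hx hy) := by
  unfold grClass
  rw [DirectSum.of_mul_of]
  rfl

theorem grClass_add {l : ℕ} {x y : R} (hx : x ∈ I ^ l) (hy : y ∈ I ^ l) :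
    grClass I l (x + y) (add_mem hx hy) = grClass I l x hx + grClass I l y hy := by
  unfold grClass
  rw [← map_add, ← map_add]
  rfl

theorem grClass_sum {ι : Type*} (s : Finset ι) {l : ℕ} {x : ι → R} (hx : ∀ i, x i ∈ I ^ l) :
    grClass I l (∑ i ∈ s, x i) (Ideal.sum_mem _ fun i _ => hx i) =
      ∑ i ∈ s, grClass I l (x i) (hx i) := by
  refine Eq.trans ?_ (map_sum ((DirectSum.of (GrPiece I) l).comp (grMk I l))
    (fun i => (⟨x i, hx i⟩ : ↥(I ^ l))) s)
  change DirectSum.of (GrPiece I) l (grMk I l _) = DirectSum.of (GrPiece I) l (grMk I l _)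
  congr 2
  exact Subtype.ext (by simp)

theorem algebraMap_mk_eq_grClass (a : R) :
    algebraMap (R ⧸ I) (Gr I) (Ideal.Quotient.mk I a) = grClass I 0 a (by simp) := rfl

theorem exists_grClass_eq_of_mem_grDeg {l : ℕ} {z : Gr I} (hz : z ∈ grDeg I l) :
    ∃ (x : R) (hx : x ∈ I ^ l), grClass I l x hx = z := by
  obtain ⟨y, rfl⟩ := hz
  obtain ⟨⟨x, hx⟩, rfl⟩ := grMk_surjective I l y
  exact ⟨x, hx, rfl⟩

theorem grClass_mem_grDeg {l : ℕ} {x : R} (hx : x ∈ I ^ l) : grClass I l x hx ∈ grDeg I l :=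
  ⟨_, rfl⟩

theorem notMem_iInf_pow {p : R} {l : ℕ} (h : p ∉ I ^ l) : p ∉ ⨅ k : ℕ, I ^ k :=
  fun hp => h (Ideal.mem_iInf.1 hp l)

theorem ord_eq {p : R} {l : ℕ} (h : p ∈ I ^ l) (h' : p ∉ I ^ (l + 1)) : ord I p = l := by
  refine le_antisymm (iSup_le fun k => ?_) (le_iSup (fun k : {k : ℕ // p ∈ I ^ k} =>
    ((k : ℕ) : ℕ∞)) ⟨l, h⟩)
  have : (k : ℕ) ≤ l := by
    by_contra hk
    exact h' (Ideal.pow_le_pow_right (by omega) k.2)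
  exact_mod_cast this

theorem symb_eq_grClass {p : R} {l : ℕ} (h : p ∈ I ^ l) (h' : p ∉ I ^ (l + 1)) :
    symb I p = grClass I l p h := by
  rw [symb, if_neg (notMem_iInf_pow h')]
  exact grClass_congr (by rw [ord_eq h h']; rfl) rfl _ _

theorem ord_eq_top_iff {p : R} : ord I p = ⊤ ↔ p ∈ ⨅ k : ℕ, I ^ k := by
  constructor
  · intro h
    rw [Ideal.mem_iInf]
    intro k
    by_contra hk
    have : ord I p ≤ (k : ℕ∞) := iSup_le fun j => by
      have : (j : ℕ) ≤ k := by
        by_contra hj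
        exact hk (Ideal.pow_le_pow_right (by omega) j.2)
      exact_mod_cast this
    rw [h, top_le_iff] at this
    exact ENat.natCast_ne_top k this
  · intro h
    rw [ENat.eq_top_iff_forall_ge]
    exact fun k => le_iSup (fun k : {k : ℕ // p ∈ I ^ k} => ((k : ℕ) : ℕ∞))
      ⟨k, Ideal.mem_iInf.1 h k⟩

theorem mon_single {S σ : Type*} [CommRing S] [Fintype σ] (x : σ → S) (j : σ) :
    mon x (Finsupp.single j 1 : σ →₀ ℕ) = x j := by
  classical
  rw [mon, Finset.prod_eq_single j (fun i _ hi => by simp [hi.symm]) (by simp)]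
  simp

theorem mon_zero {S σ : Type*} [CommRing S] [Fintype σ] (x : σ → S) :
    mon x (0 : σ →₀ ℕ) = 1 := by
  simp [mon]

theorem mon_grClass {σ : Type*} [Fintype σ] (g : σ → R) (m : σ →₀ ℕ) :
    mon (fun j => grClass (Ideal.span (Set.range g)) 1 (g j)
      (by rw [pow_one]; exact Ideal.subset_span ⟨j, rfl⟩)) m =
      grClass (Ideal.span (Set.range g)) m.degree (mon g m) (mon_mem_pow_degree g m) := by
  have hg : ∀ j, g j ∈ Ideal.span (Set.range g) ^ 1 := fun j => by
    rw [pow_one]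
    exact Ideal.subset_span ⟨j, rfl⟩
  let p : (σ →₀ ℕ) → Prop := fun m =>
    mon (fun j => grClass (Ideal.span (Set.range g)) 1 (g j) (hg j)) m =
      grClass (Ideal.span (Set.range g)) m.degree (mon g m) (mon_mem_pow_degree g m)
  have hzero : p 0 := by
    refine (mon_zero _).trans ?_
    exact grClass_congr (i := 0) (map_zero Finsupp.degree).symm (mon_zero g).symm (by simp) _
  have hadd : ∀ m n, p m → p n → p (m + n) := fun m n hm hn => by
    change mon _ _ = _
    refine ((congrArg (mon _) (Finsupp.coe_add m n)).trans (mon_add _ _ _)).trans ?_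
    refine (congrArg₂ _ hm hn).trans ((grClass_mul _ _).trans ?_)
    exact grClass_congr (map_add Finsupp.degree m n).symm (by rw [Finsupp.coe_add, mon_add]) _ _
  change p m
  induction m using Finsupp.induction_linear with
  | zero => exact hzero
  | add m n hm hn => exact hadd m n hm hn
  | single j k =>
    induction k with
    | zero => simpa only [Finsupp.single_zero] using hzero
    | succ k ih =>
      rw [Finsupp.single_add]
      refine hadd _ _ ih ((mon_single _ j).trans ?_)
      exact grClass_congr (Finsupp.degree_single j 1).symm (mon_single g j).symm _ _

end Classes

/-! ### The Rees map of a quasi-regular family is a graded isomorphism -/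

section Rees

variable {R : Type*} [CommRing R] {s : ℕ} {g : Fin s → R}

theorem IsQuasiRegular.notMem_pow_two (hg : IsQuasiRegular g) (hI : idealOf g ≠ ⊤) (i : Fin s) :
    g i ∉ idealOf g ^ (1 + 1) := by
  intro h
  have := hg 1 (X i) (isHomogeneous_X R i) (by rwa [eval_X]) (Finsupp.single i 1)
  rw [coeff_X, if_pos rfl] at this
  exact hI ((Ideal.eq_top_iff_one _).2 this)

theorem IsQuasiRegular.symb_eq (hg : IsQuasiRegular g) (hI : idealOf g ≠ ⊤) (i : Fin s) :
    symb (idealOf g) (g i) =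
      grClass (idealOf g) 1 (g i) (by rw [pow_one]; exact Ideal.subset_span ⟨i, rfl⟩) :=
  symb_eq_grClass _ (hg.notMem_pow_two hI i)

theorem eval_mem_pow {P : MvPolynomial (Fin s) R} {l : ℕ} (hP : P.IsHomogeneous l) :
    eval g P ∈ idealOf g ^ l :=
  (Ideal.mem_span_pow_iff_exists_isHomogeneous g _).2 ⟨P, hP, rfl⟩

/-- Computes the Rees map on lifts to `R`. This reduces its kernel and image to values of forms at
`g`. -/
theorem IsQuasiRegular.reesMap_map (hg : IsQuasiRegular g) (hI : idealOf g ≠ ⊤)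
    {P : MvPolynomial (Fin s) R} {l : ℕ} (hP : P.IsHomogeneous l) :
    reesMap g (map (Ideal.Quotient.mk (idealOf g)) P) =
      grClass (idealOf g) l (eval g P) (eval_mem_pow hP) := by
  have hmon : ∀ m, coeff m P * mon g m ∈ idealOf g ^ l := fun m => by
    by_cases hm : coeff m P = 0
    · simp [hm]
    · rw [← degree_eq_of_coeff_ne_zero hP hm]
      exact Ideal.mul_mem_left _ _ (mon_mem_pow_degree g m)
  rw [grClass_congr rfl (eval_eq_sum_mon g P) _ (Ideal.sum_mem _ fun m _ => hmon m),
    grClass_sum _ hmon]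
  conv_lhs => rw [P.as_sum, map_sum, map_sum]
  refine Finset.sum_congr rfl fun m hm => ?_
  have hdeg := degree_eq_of_coeff_ne_zero hP (mem_support_iff.1 hm)
  rw [map_monomial, reesMap, aeval_monomial, Finsupp.prod_fintype _ _ (by simp)]
  simp_rw [hg.symb_eq hI]
  have := mon_grClass g m
  rw [mon] at this
  rw [this, algebraMap_mk_eq_grClass, grClass_mul]
  exact grClass_congr (by omega) rfl _ _

theorem exists_homogeneous_lift {I : Ideal R} {P : MvPolynomial (Fin s) (R ⧸ I)} {l : ℕ}
    (hP : P.IsHomogeneous l) :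
    ∃ Q : MvPolynomial (Fin s) R, Q.IsHomogeneous l ∧ map (Ideal.Quotient.mk I) Q = P := by
  obtain ⟨Q, rfl⟩ := map_surjective (Ideal.Quotient.mk I) Ideal.Quotient.mk_surjective P
  refine ⟨homogeneousComponent l Q, homogeneousComponent_isHomogeneous l Q, ?_⟩
  ext m
  rw [coeff_map, coeff_homogeneousComponent, coeff_map]
  split_ifs with h
  · rfl
  · rw [map_zero, ← coeff_map, hP.coeff_eq_zero h]

theorem IsQuasiRegular.reesMap_injective (hg : IsQuasiRegular g) (hI : idealOf g ≠ ⊤) :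
    Function.Injective (reesMap g) := by
  rw [injective_iff_map_eq_zero]
  intro P hP
  obtain ⟨P, rfl⟩ := map_surjective (Ideal.Quotient.mk (idealOf g)) Ideal.Quotient.mk_surjective P
  have hsum : ∑ l ∈ Finset.range (P.totalDegree + 1), grClass (idealOf g) l
      (eval g (homogeneousComponent l P))
      (eval_mem_pow (homogeneousComponent_isHomogeneous l P)) = 0 := by
    rw [← hP]
    conv_rhs => rw [← P.sum_homogeneousComponent, map_sum, map_sum]
    exact Finset.sum_congr rfl fun l _ =>
      (hg.reesMap_map hI (homogeneousComponent_isHomogeneous l P)).symm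
  ext m
  rw [coeff_map, coeff_zero, Ideal.Quotient.eq_zero_iff_mem]
  by_cases hm : m.degree ∈ Finset.range (P.totalDegree + 1)
  -- The component in the degree of `m` isolates one homogeneous part of `P`, to which
  -- quasi-regularity applies.
  · have h1 := DFunLike.congr_fun hsum m.degree
    rw [DFinsupp.finsetSum_apply, Finset.sum_eq_single_of_mem _ hm
      (fun l _ hl => DirectSum.of_eq_of_ne _ _ _ hl.symm), grClass, DirectSum.of_eq_same] at h1
    have h2 : eval g (homogeneousComponent m.degree P) ∈ idealOf g ^ (m.degree + 1) := by
      rw [← grClass_eq_zero_iff (eval_mem_pow (homogeneousComponent_isHomogeneous _ P)), grClass,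
        h1]
      exact map_zero _
    have := hg _ _ (homogeneousComponent_isHomogeneous _ P) h2 m
    rwa [coeff_homogeneousComponent, if_pos rfl] at this
  · have : coeff m P = 0 := by
      by_contra h
      have := le_totalDegree (mem_support_iff.2 h)
      rw [Finset.mem_range, Finsupp.degree_apply] at hm
      exact hm (Nat.lt_succ_of_le this)
    simp [this]

theorem IsQuasiRegular.reesMap_image (hg : IsQuasiRegular g) (hI : idealOf g ≠ ⊤) (l : ℕ) :
    reesMap g '' {P | P.IsHomogeneous l} = grDeg (idealOf g) l := by
  ext z
  constructor
  · rintro ⟨P, hP, rfl⟩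
    obtain ⟨Q, hQ, rfl⟩ := exists_homogeneous_lift hP
    rw [hg.reesMap_map hI hQ]
    exact grClass_mem_grDeg _
  · intro hz
    obtain ⟨x, hx, rfl⟩ := exists_grClass_eq_of_mem_grDeg hz
    obtain ⟨P, hP, rfl⟩ := (Ideal.mem_span_pow_iff_exists_isHomogeneous g _).1 hx
    exact ⟨_, hP.map _, hg.reesMap_map hI hP⟩

theorem IsQuasiRegular.reesMap_surjective (hg : IsQuasiRegular g) (hI : idealOf g ≠ ⊤) :
    Function.Surjective (reesMap g) := by
  intro z
  induction z using DirectSum.induction_on with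
  | zero => exact ⟨0, map_zero _⟩
  | of l y =>
    obtain ⟨P, -, h⟩ := (hg.reesMap_image hI l).symm.subset ⟨y, rfl⟩
    exact ⟨P, h⟩
  | add x y hx hy =>
    obtain ⟨P, rfl⟩ := hx
    obtain ⟨Q, rfl⟩ := hy
    exact ⟨P + Q, map_add _ _ _⟩

end Rees

/-! ### The graded map to a quotient ring and its kernel -/

section Functoriality

variable {R : Type*} [CommRing R] (I J : Ideal R)

theorem mk_mem_map_pow {l : ℕ} {x : R} (hx : x ∈ I ^ l) :
    Ideal.Quotient.mk J x ∈ I.map (Ideal.Quotient.mk J) ^ l := by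
  rw [← Ideal.map_pow]
  exact Ideal.mem_map_of_mem _ hx

/-- The map `I ^ l → Ī ^ l / Ī ^ (l + 1)`, where `Ī` is the image of `I` in `R / J`. -/
def powToGrPiece (l : ℕ) : ↥(I ^ l) →+ GrPiece (I.map (Ideal.Quotient.mk J)) l :=
  (grMk _ l).comp
    (AddMonoidHom.mk' (fun x => ⟨Ideal.Quotient.mk J x, mk_mem_map_pow I J x.2⟩) fun _ _ => rfl)

theorem ker_grMk_le (l : ℕ) : (grMk I l).ker ≤ (powToGrPiece I J l).ker := by
  intro x hx
  rw [AddMonoidHom.mem_ker, ← map_zero (grMk I l), grMk_eq_iff] at hx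
  rw [ZeroMemClass.coe_zero, sub_zero] at hx
  rw [AddMonoidHom.mem_ker, powToGrPiece, AddMonoidHom.comp_apply, ← map_zero (grMk _ l),
    grMk_eq_iff, ZeroMemClass.coe_zero, sub_zero]
  exact mk_mem_map_pow I J hx

/-- The map `I ^ l / I ^ (l + 1) → Ī ^ l / Ī ^ (l + 1)`, where `Ī` is the image of `I` in
`R / J`. -/
def grPieceMap (l : ℕ) : GrPiece I l →+ GrPiece (I.map (Ideal.Quotient.mk J)) l :=
  AddMonoidHom.liftOfSurjective (grMk I l) (grMk_surjective I l)
    ⟨powToGrPiece I J l, ker_grMk_le I J l⟩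

theorem grPieceMap_grMk (l : ℕ) (x : ↥(I ^ l)) :
    grPieceMap I J l (grMk I l x) = grMk _ l ⟨Ideal.Quotient.mk J x, mk_mem_map_pow I J x.2⟩ :=
  AddMonoidHom.liftOfRightInverse_comp_apply _ _ _ ⟨powToGrPiece I J l, ker_grMk_le I J l⟩ x

/-- The ring homomorphism `gr_I R → gr_Ī (R / J)`. -/
def grMapRingHom : Gr I →+* Gr (I.map (Ideal.Quotient.mk J)) :=
  DirectSum.toSemiring (fun l => (DirectSum.of _ l).comp (grPieceMap I J l))
    (by
      change DirectSum.of _ 0 (grPieceMap I J 0 (grMk I 0 _)) = _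
      rw [grPieceMap_grMk]
      rfl)
    (by
      intro i j a b
      obtain ⟨a, rfl⟩ := grMk_surjective I i a
      obtain ⟨b, rfl⟩ := grMk_surjective I j b
      change DirectSum.of _ (i + j) (grPieceMap I J (i + j) (grMk I (i + j) (powMul I a b))) =
        DirectSum.of _ i (grPieceMap I J i (grMk I i a)) *
          DirectSum.of _ j (grPieceMap I J j (grMk I j b))
      rw [grPieceMap_grMk, grPieceMap_grMk, grPieceMap_grMk, DirectSum.of_mul_of]
      rfl)

theorem grMapRingHom_of (l : ℕ) (y : GrPiece I l) :
    grMapRingHom I J (DirectSum.of _ l y) = DirectSum.of _ l (grPieceMap I J l y) :=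
  DirectSum.toSemiring_of _ _ _ l y

theorem grMapRingHom_grClass {l : ℕ} {x : R} (hx : x ∈ I ^ l) :
    grMapRingHom I J (grClass I l x hx) =
      grClass _ l (Ideal.Quotient.mk J x) (mk_mem_map_pow I J hx) := by
  rw [grClass, grMapRingHom_of, grPieceMap_grMk]
  rfl

/-- The `R / I`-algebra homomorphism `gr_I R → gr_Ī (R / J)`. -/
def grMap : Gr I →ₐ[R ⧸ I] Gr (I.map (Ideal.Quotient.mk J)) where
  __ := grMapRingHom I J
  commutes' a := by
    obtain ⟨a, rfl⟩ := Ideal.Quotient.mk_surjective a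
    exact grMapRingHom_grClass I J (l := 0) (x := a) (by simp)

theorem grMap_grClass {l : ℕ} {x : R} (hx : x ∈ I ^ l) :
    grMap I J (grClass I l x hx) =
      grClass _ l (Ideal.Quotient.mk J x) (mk_mem_map_pow I J hx) :=
  grMapRingHom_grClass I J hx

theorem grMap_of (l : ℕ) (y : GrPiece I l) :
    grMap I J (DirectSum.of _ l y) = DirectSum.of _ l (grPieceMap I J l y) :=
  grMapRingHom_of I J l y

theorem grMap_apply (z : Gr I) (l : ℕ) : grMap I J z l = grPieceMap I J l (z l) := by
  induction z using DirectSum.induction_on with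
  | zero => simp
  | of i y =>
    rw [grMap_of]
    rcases eq_or_ne i l with rfl | h
    · rw [DirectSum.of_eq_same, DirectSum.of_eq_same]
    · rw [DirectSum.of_eq_of_ne _ _ _ h.symm, DirectSum.of_eq_of_ne _ _ _ h.symm, map_zero]
  | add x y hx hy =>
    rw [map_add, DirectSum.add_apply, DirectSum.add_apply, hx, hy, map_add]

theorem grMap_image (l : ℕ) :
    grMap I J '' grDeg I l = grDeg (I.map (Ideal.Quotient.mk J)) l := by
  ext z
  constructor
  · rintro ⟨_, ⟨y, rfl⟩, rfl⟩
    exact ⟨_, (grMap_of I J l y).symm⟩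
  · intro hz
    obtain ⟨x, hx, rfl⟩ := exists_grClass_eq_of_mem_grDeg hz
    have hx' := hx
    rw [← Ideal.map_pow, Ideal.mem_map_iff_of_surjective _ Ideal.Quotient.mk_surjective] at hx'
    obtain ⟨y, hy, rfl⟩ := hx'
    exact ⟨_, grClass_mem_grDeg hy, grMap_grClass I J hy⟩

theorem grMap_surjective : Function.Surjective (grMap I J) := by
  intro z
  induction z using DirectSum.induction_on with
  | zero => exact ⟨0, map_zero _⟩
  | of l y =>
    obtain ⟨x, -, h⟩ := (grMap_image I J l).symm.subset ⟨y, rfl⟩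
    exact ⟨x, h⟩
  | add x y hx hy =>
    obtain ⟨a, rfl⟩ := hx
    obtain ⟨b, rfl⟩ := hy
    exact ⟨a + b, map_add _ _ _⟩

/-- If `R ^ u → R`, `e_i ↦ h i`, is strict for the shifts `d`, then the kernel of
`gr_I R → gr_Ī (R / ⟨h⟩)` is generated by the classes of the `h i` in degree `d i`. -/
theorem ker_grMap_eq_span {u : ℕ} (h : Fin u → R) (d : Fin u → ℕ) (hd : ∀ i, h i ∈ I ^ d i)
    (hstrict : IsStrict (shiftedFiltration I d) (fun k => I ^ k) (rowMap h)) :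
    RingHom.ker (grMap I (idealOf h)) =
      Ideal.span (Set.range fun i => grClass I (d i) (h i) (hd i)) := by
  classical
  apply le_antisymm
  · intro z hz
    rw [← DirectSum.sum_support_of z]
    refine Ideal.sum_mem _ fun l _ => ?_
    have h0 : grPieceMap I (idealOf h) l (z l) = 0 := by
      rw [← grMap_apply, (RingHom.mem_ker).1 hz]
      rfl
    obtain ⟨⟨x, hx⟩, hxz⟩ := grMk_surjective I l (z l)
    rw [← hxz] at h0 ⊢
    change grClass I l x hx ∈ _
    rw [grPieceMap_grMk, ← map_zero (grMk _ l), grMk_eq_iff] at h0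
    simp only [ZeroMemClass.coe_zero, sub_zero] at h0
    rw [← Ideal.map_pow, Ideal.mem_quotient_iff_mem_sup] at h0
    -- The representative splits as `y + j` with `y` in `I^(l+1)`, of class zero, and `j` in `⟨h⟩ ∩
    -- I^l`, to which strictness applies.
    obtain ⟨y, hy, j, hj, rfl⟩ := Submodule.mem_sup.1 h0
    have hyl : y ∈ I ^ l := Ideal.pow_le_pow_right l.le_succ hy
    have hjl : j ∈ I ^ l := (Ideal.add_mem_iff_right _ hyl).1 hx
    have hjm : j ∈ (shiftedFiltration I d l).map (rowMap h) := by
      rw [hstrict l]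
      refine ⟨hjl, ?_⟩
      obtain ⟨c, hc⟩ := Ideal.mem_span_range_iff_exists_fun.1 hj
      exact ⟨c, by simpa [rowMap, Fintype.linearCombination_apply] using hc⟩
    obtain ⟨a, ha, rfl⟩ := hjm
    have hai : ∀ i, a i ∈ I ^ (l - d i) := fun i => ha i trivial
    have hterm : ∀ i, a i * h i ∈ I ^ l := fun i => by
      have := Ideal.mul_mem_mul (hai i) (hd i)
      rw [← pow_add] at this
      exact Ideal.pow_le_pow_right (by omega) this
    have hrow : rowMap h a = ∑ i, a i * h i := by
      simp [rowMap, Fintype.linearCombination_apply]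
    rw [grClass_add hyl hjl, (grClass_eq_zero_iff hyl).2 hy, zero_add,
      grClass_congr rfl hrow hjl (Ideal.sum_mem _ fun i _ => hterm i), grClass_sum _ hterm]
    refine Ideal.sum_mem _ fun i _ => ?_
    by_cases hi : d i ≤ l
    · rw [← grClass_congr (i := l - d i + d i) (by omega) rfl
        (by rw [pow_add]; exact Ideal.mul_mem_mul (hai i) (hd i)) (hterm i),
        ← grClass_mul (hai i) (hd i)]
      exact Ideal.mul_mem_left _ _ (Ideal.subset_span ⟨i, rfl⟩)
    -- Here `d i > l`, so the term already lies in `I^(l+1)`.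
    · rw [(grClass_eq_zero_iff (hterm i)).2]
      · exact zero_mem _
      · exact Ideal.mul_mem_left _ _ (Ideal.pow_le_pow_right (by omega) (hd i))
  · rw [Ideal.span_le]
    rintro _ ⟨i, rfl⟩
    rw [SetLike.mem_coe, RingHom.mem_ker, grMap_grClass, grClass_eq_zero_iff,
      Ideal.Quotient.eq_zero_iff_mem.2 (Ideal.subset_span (Set.mem_range_self i))]
    exact zero_mem _

/-- Equal orders make both symbols classes in the same degree; when both orders are infinite, both
symbols take the default value `0`. -/
theorem grMap_symb {x : R}
    (hx : ord (I.map (Ideal.Quotient.mk J)) (Ideal.Quotient.mk J x) = ord I x) :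
    grMap I J (symb I x) = symb _ (Ideal.Quotient.mk J x) := by
  unfold symb
  by_cases h : x ∈ ⨅ k : ℕ, I ^ k
  · rw [if_pos h, if_pos (ord_eq_top_iff.1 (hx.trans (ord_eq_top_iff.2 h))), map_zero]
  · rw [if_neg h, if_neg (fun h' => h (ord_eq_top_iff.1 (hx.symm.trans (ord_eq_top_iff.2 h')))),
      grMap_grClass]
    exact grClass_congr (by rw [hx]) rfl _ _

end Functoriality

/-! ### The monomials `h^{m_i}`: strictness, order and symbols -/

section Monomials

variable {R : Type*} [CommRing R] {r s u : ℕ} {f : Fin r → R} {g : Fin s → R}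
  (K : Matrix (Fin u) (Fin r) ℕ) (L : Matrix (Fin u) (Fin s) ℕ)

theorem hM_eq (f : Fin r → R) (g : Fin s → R) (i : Fin u) :
    hM f g K L i = mon f (K i) * mon g (L i) := by
  simp [hM, mon, Fintype.prod_sum_type]

theorem mon_mem_pow_sum (g : Fin s → R) (i : Fin u) : mon g (L i) ∈ idealOf g ^ ∑ j, L i j := by
  have := mon_mem_pow_degree g (Finsupp.equivFunOnFinite.symm (L i))
  rwa [Finsupp.degree_eq_sum] at this

theorem hM_mem_pow (f : Fin r → R) (g : Fin s → R) (i : Fin u) :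
    hM f g K L i ∈ idealOf g ^ ∑ j, L i j := by
  rw [hM_eq]
  exact Ideal.mul_mem_left _ _ (mon_mem_pow_sum L g i)

variable (hg : IsQuasiRegular g)
  (hf : IsQuasiRegular fun j => Ideal.Quotient.mk (idealOf g) (f j))
  (hI : idealOf g ≠ ⊤)
  (hc : IsAdicComplete (idealOf fun j => Ideal.Quotient.mk (idealOf g) (f j)) (R ⧸ idealOf g))

include hg hf hc in
theorem isStrict_rowMap_hM :
    IsStrict (shiftedFiltration (idealOf g) fun i => ∑ j, L i j) (fun k => idealOf g ^ k)
      (rowMap (hM f g K L)) := by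
  intro k
  have hrow : ∀ a, rowMap (hM f g K L) a = ∑ i, a i * hM f g K L i := fun a => by
    simp [rowMap, Fintype.linearCombination_apply]
  ext x
  constructor
  · rintro ⟨a, ha, rfl⟩
    refine ⟨?_, a, rfl⟩
    rw [hrow]
    refine Ideal.sum_mem _ fun i _ => ?_
    have := Ideal.mul_mem_mul (ha i trivial) (hM_mem_pow K L f g i)
    rw [← pow_add] at this
    exact Ideal.pow_le_pow_right le_tsub_add this
  · rintro ⟨hx, a, rfl⟩
    have he : ∀ i, hM f g K L i = mon f (Finsupp.equivFunOnFinite.symm (K i)) *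
        mon g (Finsupp.equivFunOnFinite.symm (L i)) := hM_eq K L f g
    obtain ⟨a', h1, h2⟩ := hg.exists_strict_representation
      (fun i => mon f (Finsupp.equivFunOnFinite.symm (K i)))
      (fun i => Finsupp.equivFunOnFinite.symm (L i))
      (exists_coeff_mem_of_sum_mon_mem hf _) k a (by
        rw [SetLike.mem_coe, hrow] at hx
        simpa only [he] using hx)
    refine ⟨a', fun i _ => ?_, ?_⟩
    · have := h1 i
      rwa [Finsupp.degree_eq_sum] at this
    · rw [hrow, hrow]
      simpa only [he] using h2

include hg hf hI hc in
-- Otherwise quasi-regularity of `g`, applied to the form `f^{k_i} Y^{l_i}`, would give `f̄^{k_i} =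
-- 0`. Hence the order of `h^{m_i}` is exactly `|l_i|`.
theorem hM_notMem_pow (i : Fin u) : hM f g K L i ∉ idealOf g ^ ((∑ j, L i j) + 1) := by
  intro h
  have : Nontrivial (R ⧸ idealOf g) := Ideal.Quotient.nontrivial_iff.2 hI
  have h1 := hg (∑ j, L i j) (monomial (Finsupp.equivFunOnFinite.symm (L i)) (mon f (K i)))
    (isHomogeneous_monomial _ (Finsupp.degree_eq_sum _))
    (by rw [eval_monomial_eq_mon]; rwa [hM_eq] at h) (Finsupp.equivFunOnFinite.symm (L i))
  rw [coeff_monomial, if_pos rfl, ← Ideal.Quotient.eq_zero_iff_mem, map_mon] at h1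
  exact hf.mon_ne_zero (Finsupp.equivFunOnFinite.symm (K i)) h1

include hg hf hI hc in
theorem symb_hM (i : Fin u) : symb (idealOf g) (hM f g K L i) =
    grClass (idealOf g) (∑ j, L i j) (hM f g K L i) (hM_mem_pow K L f g i) :=
  symb_eq_grClass _ (hM_notMem_pow K L hg hf hI hc i)

include hg hf hI hc in
theorem map_reesMap_polyIdeal :
    (polyIdeal f g K L).map (reesMap g : _ →+* Gr (idealOf g)) = symbIdeal f g K L := by
  rw [polyIdeal, symbIdeal, Ideal.map_span, ← Set.range_comp]
  congr 2
  ext1 i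
  rw [symb_hM K L hg hf hI hc]
  have hh : (monomial (Finsupp.equivFunOnFinite.symm (L i)) (mon f (K i))).IsHomogeneous
      (∑ j, L i j) := isHomogeneous_monomial _ (Finsupp.degree_eq_sum _)
  have h1 := hg.reesMap_map hI hh
  rw [map_monomial, monomial_eq_C_mul_mon, map_mon] at h1
  refine h1.trans (grClass_congr rfl ?_ _ _)
  rw [eval_monomial_eq_mon, hM_eq]
  rfl

end Monomials

end ReesStrict

end

/-! ### The main theorem -/

open ReesStrict in
theorem proposition2 {R : Type*} [CommRing R] {r s u : ℕ} (f : Fin r → R) (g : Fin s → R)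
    (K : Matrix (Fin u) (Fin r) ℕ) (L : Matrix (Fin u) (Fin s) ℕ)
    (hKL : ∀ i, Matrix.fromCols K L i ≠ 0)
    (hfg : RingTheory.Sequence.IsRegular R (List.ofFn f ++ List.ofFn g))
    (hgf : RingTheory.Sequence.IsRegular R (List.ofFn g ++ List.ofFn f))
    (hcomplete : IsAdicComplete (idealOf fun j => Ideal.Quotient.mk (idealOf g) (f j))
      (R ⧸ idealOf g)) :
    -- strictness of the map given by the monomials
    IsStrict (shiftedFiltration (idealOf g) fun i => ∑ j, L i j) (fun k => idealOf g ^ k)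
      (rowMap (hM f g K L)) ∧
    -- all symbols that occur are defined
    (∀ i, g i ∉ ⨅ k : ℕ, idealOf g ^ k) ∧
    (∀ i, hM f g K L i ∉ ⨅ k : ℕ, idealOf g ^ k) ∧
    -- the first isomorphism is graded and induced by the Rees map
    (∃ e₁ : (MvPolynomial (Fin s) (R ⧸ idealOf g) ⧸ polyIdeal f g K L) ≃ₐ[R ⧸ idealOf g]
        (Gr (idealOf g) ⧸ symbIdeal f g K L),
      (∀ P, e₁ (Ideal.Quotient.mk _ P) = Ideal.Quotient.mk _ (reesMap g P)) ∧
      ∀ l : ℕ, e₁ '' (Ideal.Quotient.mk _ '' {P | P.IsHomogeneous l}) =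
        Ideal.Quotient.mk _ '' grDeg (idealOf g) l) ∧
    -- the second isomorphism is graded and takes classes to classes, symbols to symbols
    ∃ e₂ : (Gr (idealOf g) ⧸ symbIdeal f g K L) ≃ₐ[R ⧸ idealOf g]
        Gr ((idealOf g).map (Ideal.Quotient.mk (idealOf (hM f g K L)))),
      (∀ l : ℕ, e₂ '' (Ideal.Quotient.mk _ '' grDeg (idealOf g) l) = grDeg _ l) ∧
      (∀ (l : ℕ) (x : R) (hx : x ∈ idealOf g ^ l),
        e₂ (Ideal.Quotient.mk _ (grClass (idealOf g) l x hx)) =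
          grClass _ l (Ideal.Quotient.mk _ x)
            (by rw [← Ideal.map_pow]; exact Ideal.mem_map_of_mem _ hx)) ∧
      ∀ x : R,
        ord ((idealOf g).map (Ideal.Quotient.mk (idealOf (hM f g K L))))
          (Ideal.Quotient.mk _ x) = ord (idealOf g) x →
        e₂ (Ideal.Quotient.mk _ (symb (idealOf g) x)) = symb _ (Ideal.Quotient.mk _ x) := by
  have hI : idealOf g ≠ ⊤ := by
    intro h
    apply hgf.top_ne_smul
    rw [Ideal.ofList_append, ofList_ofFn, h]
    simp
  have hg : IsQuasiRegular g := isQuasiRegular_of_isWeaklyRegular g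
    ((RingTheory.Sequence.isWeaklyRegular_append_iff R _ _).1 hgf.toIsWeaklyRegular).1
  have hf := isQuasiRegular_mk_of_isWeaklyRegular_append g f hgf.toIsWeaklyRegular
  have hstrict := isStrict_rowMap_hM K L hg hf hcomplete
  refine ⟨hstrict, fun i => notMem_iInf_pow (hg.notMem_pow_two hI i),
    fun i => notMem_iInf_pow (hM_notMem_pow K L hg hf hI hcomplete i), ?_, ?_⟩
  · refine ⟨Ideal.quotientEquivAlg _ _
      (AlgEquiv.ofBijective (reesMap g) ⟨hg.reesMap_injective hI, hg.reesMap_surjective hI⟩)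
      (map_reesMap_polyIdeal K L hg hf hI hcomplete).symm, fun P => rfl, fun l => ?_⟩
    rw [← hg.reesMap_image hI l, Set.image_image, Set.image_image]
    rfl
  -- The shifts in the strictness statement are the orders of the `h^{m_i}`, so the classes
  -- generating the kernel are their symbols.
  · have hker : symbIdeal f g K L = RingHom.ker (grMap (idealOf g) (idealOf (hM f g K L))) := by
      rw [ker_grMap_eq_span _ _ _ (hM_mem_pow K L f g) hstrict, symbIdeal]
      simp_rw [symb_hM K L hg hf hI hcomplete]
    refine ⟨(Ideal.quotientEquivAlgOfEq _ hker).trans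
      (Ideal.quotientKerAlgEquivOfSurjective (grMap_surjective _ _)), fun l => ?_,
      fun l x hx => grMap_grClass _ _ hx, fun x hx => grMap_symb _ _ hx⟩
    rw [← grMap_image, Set.image_image]
    rfl
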